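/- For a symmetric matrix $B\in\mathbb R^{n\times n}$ let $I_B\subseteq\{1,\dots,n\}$ (its node-level support) be an index set $I$ of smallest cardinality such that $\|B_{i,\cdot}\|_2=\|B_{\cdot,i}\|_2>0$ for all $i\in I$ and $B_{ij}=0$ for all $i,j\in I^c$ (if several sets attain the smallest cardinality, one of them is fixed), and let $\eta=\eta(B)\in\{0,1\}^n$ be given by $\eta_i=\mathbf 1\{i\in I_B\}$. For $\beta\in\mathbb R$ put $$\mathcal B'_S(\beta,n,m)=\Big\{B\in\mathbb R^{n\times n}\text{ symmetric}:\ |I_B|\le m,\ |B_{ij}|\ge\beta\ \ \forall i\in I_B,\,j\in I_B^c,\ \ B_{ij}=0\ \ \forall i,j\in I_B^c\Big\}.$$ Suppose we observe $N\ge1$ independent samples $\widetilde Y_\ell=B^\star+W_\ell$, $\ell=1,\dots,N$, where the $W_\ell$ are independent symmetric noise matrices whose entries $(W_{\ell,ij})_{1\le i\le j\le n}$ are i.i.d. $\mathcal N(0,\sigma^2)$, $\sigma>0$. There exist universal constants $C>0$ and $n_0\in\mathbb N$ such that for all $n\ge n_0$, all $N\ge1$, all integers $m$ with $m<n/3$,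 all real $m'\in[1,m]$, all $\sigma>0$ and all $\beta$ with $$\beta<\frac{C\,\sigma\, n^{-1/4}\log^{1/4}\!\big(n/(3m')\big)}{\sqrt N},$$ we have $$\inf_{\hat\eta}\ \sup_{B^\star\in\mathcal B'_S(\beta,n,m)}\mathbb E_{B^\star}\sum_{j=1}^n|\hat\eta_j-\eta_j|\ \ge\ 4m'\left[\frac18-\exp\!\left(-\frac{(m-m')^2}{2m}\right)\right],$$ where $\eta=\eta(B^\star)$ and the infimum is over all measurable functions $\hat\eta$ of $(\widetilde Y_1,\dots,\widetilde Y_N)$ with values in $[0,1]^n$. -/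

import Mathlib

open MeasureTheory ProbabilityTheory
open scoped ENNReal

noncomputable section

/-- The group-sparsity condition on a matrix `B` and an index set `I`: every row (and column)
indexed by `I` has the same positive Euclidean norm as its transposed column (row), and `B`
vanishes on `Iᶜ × Iᶜ`. -/
def GroupSparse {n : ℕ} (B : Matrix (Fin n) (Fin n) ℝ) (I : Finset (Fin n)) : Prop :=
  (∀ i ∈ I, √(∑ j, B i j ^ 2) = √(∑ j, B j i ^ 2) ∧ 0 < √(∑ j, B j i ^ 2)) ∧
    ∀ i ∉ I, ∀ j ∉ I, B i j = 0

/-- `I` is a smallest (minimum-cardinality) index set for which group sparsity of `B` holds. -/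
def IsNodeSupport {n : ℕ} (B : Matrix (Fin n) (Fin n) ℝ) (I : Finset (Fin n)) : Prop :=
  GroupSparse B I ∧ ∀ J : Finset (Fin n), GroupSparse B J → I.card ≤ J.card

/-- Every symmetric matrix has a smallest group-sparsity index set. -/
theorem exists_isNodeSupport {n : ℕ} {B : Matrix (Fin n) (Fin n) ℝ} (hB : B.IsSymm) :
    ∃ I : Finset (Fin n), IsNodeSupport B I := by
  classical
  have hne : ∃ I : Finset (Fin n), GroupSparse B I := by
    refine ⟨Finset.univ.filter fun i => 0 < √(∑ j, B j i ^ 2), ?_, ?_⟩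
    · intro i hi
      refine ⟨?_, (Finset.mem_filter.mp hi).2⟩
      simp only [hB.apply]
    · intro i hi j _
      simp only [Finset.mem_filter, Finset.mem_univ, true_and, Real.sqrt_pos, not_lt] at hi
      have h0 : ∑ k, B k i ^ 2 = 0 := le_antisymm hi (Finset.sum_nonneg fun k _ => sq_nonneg _)
      have h1 := (Finset.sum_eq_zero_iff_of_nonneg fun k _ => sq_nonneg (B k i)).mp h0 j
        (Finset.mem_univ j)
      rw [← hB.apply]
      exact pow_eq_zero_iff (two_ne_zero) |>.mp h1
  obtain ⟨I, hI⟩ := hne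
  obtain ⟨J, hJ, hmin⟩ := Finset.exists_min_image
    (Finset.univ.filter fun I : Finset (Fin n) => GroupSparse B I) Finset.card
    ⟨I, by simpa using hI⟩
  exact ⟨J, by simpa using hJ, fun K hK => hmin K (by simpa using hK)⟩

open Classical in
/-- The node-level support `I_B` of a symmetric matrix `B`: the smallest group-sparsity index set.
Should several sets attain the minimum cardinality, an arbitrary one of them is fixed. For matrices
which are not symmetric the value is a placeholder. -/
def nodeSupport {n : ℕ} (B : Matrix (Fin n) (Fin n) ℝ) : Finset (Fin n) :=
  if h : ∃ I : Finset (Fin n), IsNodeSupport B I then h.choose else ∅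

theorem isNodeSupport_nodeSupport {n : ℕ} {B : Matrix (Fin n) (Fin n) ℝ} (hB : B.IsSymm) :
    IsNodeSupport B (nodeSupport B) := by
  have h := exists_isNodeSupport hB
  rw [nodeSupport, dif_pos h]
  exact h.choose_spec

/-- The restricted class `𝓑'_S(β, n, m)`. -/
def restrictedClass (β : ℝ) (n m : ℕ) : Set (Matrix (Fin n) (Fin n) ℝ) :=
  {B | B.IsSymm ∧ (nodeSupport B).card ≤ m ∧
    (∀ i ∈ nodeSupport B, ∀ j ∉ nodeSupport B, β ≤ |B i j|) ∧
    ∀ i ∉ nodeSupport B, ∀ j ∉ nodeSupport B, B i j = 0}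

open Classical in
/-- The support indicator `η ∈ {0,1}ⁿ` of `B`. -/
def supportIndicator {n : ℕ} (B : Matrix (Fin n) (Fin n) ℝ) (i : Fin n) : ℝ :=
  if i ∈ nodeSupport B then 1 else 0

/-- The Hamming distance `∑ⱼ |aⱼ - bⱼ|`. -/
def hammingLoss {n : ℕ} (a b : Fin n → ℝ) : ℝ := ∑ j, |a j - b j|

/-- The joint law of the free entries of the `N` noise matrices: independent `𝒩(0, σ²)` variables,
one for each sample `ℓ` and each unordered pair `{i, j}` (with `i = j` allowed), that is, one for
each entry on or above the diagonal. -/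
def noiseLaw (N n : ℕ) (σ : ℝ) : Measure (Fin N → Sym2 (Fin n) → ℝ) :=
  Measure.pi fun _ => Measure.pi fun _ => gaussianReal 0 (Real.toNNReal (σ ^ 2))

/-- The symmetric noise matrix with the given free entries. -/
def noiseMatrix {n : ℕ} (w : Sym2 (Fin n) → ℝ) : Matrix (Fin n) (Fin n) ℝ :=
  Matrix.of fun i j => w s(i, j)

/-- The observations `Y_ℓ = B + W_ℓ`, recorded entrywise. -/
def observations {N n : ℕ} (B : Matrix (Fin n) (Fin n) ℝ) (w : Fin N → Sym2 (Fin n) → ℝ) :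
    Fin N → Fin n → Fin n → ℝ :=
  fun l i j => (B + noiseMatrix (w l)) i j

/-- The expected Hamming error of the estimator `e` when the signal matrix is `B`. -/
def hammingRisk {N n : ℕ} (σ : ℝ) (e : (Fin N → Fin n → Fin n → ℝ) → Fin n → ℝ)
    (B : Matrix (Fin n) (Fin n) ℝ) : ℝ≥0∞ :=
  ∫⁻ w, ENNReal.ofReal (hammingLoss (supportIndicator B) (e (observations B w))) ∂noiseLaw N n σ

/-- The minimax Hamming risk over `𝓑'_S(β, n, m)`: the infimum runs over all measurable functions of
the `N` observations with values in `[0,1]ⁿ`. -/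
def minimaxHammingRisk (N n m : ℕ) (σ β : ℝ) : ℝ≥0∞ :=
  ⨅ (e : (Fin N → Fin n → Fin n → ℝ) → Fin n → ℝ) (_ : Measurable e)
    (_ : ∀ y i, e y i ∈ Set.Icc (0 : ℝ) 1),
    ⨆ B ∈ restrictedClass β n m, hammingRisk σ e B

end

/-! The minimax risk is bounded below by a Bayes risk. The prior selects each index independently
with probability `p = m'/n`. Entries in rows or columns meeting the selected set `S` are `±b` with
independent uniform signs, and all others are zero. `S` is then the node support. Given `T = S \
{j}` and the signs already in use, deciding whether `j ∈ S` means testing a shifted Gaussian against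
its mixture over the signs of at most `n` fresh entries. The likelihood ratio has second moment at
most `exp (n c² / 2)` with `c = N b² / σ²`: random signs cancel the first-order term, so `b` enters
to the fourth power. This explains the rate `n^{-1/4} log^{1/4}`.

With `M` bounding that second moment, each test costs at least `p (1 - p M / (4 (1 - p)))`
(`mixture_testing_lower_bound`, `coordinate_testing_lower_bound`). Summing over `j` gives
`bayes_risk_lower_bound`. The prior also charges sets with `|S| > m`, which lie outside the class.
Truncating the estimator keeps its loss there below `3 |S|`, and the resulting correction is a
Chernoff tail (`sum_bernoulliWeight_card_gt_le_exp`). `minimax_lower_bound_of_moment` combines the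
two. -/

/-! ### Gaussian translations and their likelihood ratios -/

/-- A product of measures with densities has the product density. -/
theorem pi_withDensity_ofReal {ι : Type*} [Fintype ι] {E : ι → Type*}
    [∀ i, MeasurableSpace (E i)] (μ : ∀ i, Measure (E i)) [∀ i, SigmaFinite (μ i)]
    (ρ : ∀ i, E i → ℝ) (h0 : ∀ i x, 0 ≤ ρ i x) (hρ : ∀ i, Integrable (ρ i) (μ i)) :
    Measure.pi (fun i => (μ i).withDensity fun x => ENNReal.ofReal (ρ i x)) =
      (Measure.pi μ).withDensity fun x => ENNReal.ofReal (∏ i, ρ i (x i)) := by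
  have : ∀ i, IsFiniteMeasure ((μ i).withDensity fun x => ENNReal.ofReal (ρ i x)) :=
    fun i => isFiniteMeasure_withDensity_ofReal (hρ i).2
  refine Measure.pi_eq fun s hs => ?_
  have hind : ∀ i, Integrable ((s i).indicator (ρ i)) (μ i) := fun i => (hρ i).indicator (hs i)
  have hprod : ∀ x : ∀ i, E i, (Set.univ.pi s).indicator (fun x => ∏ i, ρ i (x i)) x =
      ∏ i, (s i).indicator (ρ i) (x i) := by
    intro x
    by_cases hx : x ∈ Set.univ.pi s
    · rw [Set.indicator_of_mem hx]
      exact Finset.prod_congr rfl fun i _ => (Set.indicator_of_mem (hx i trivial) _).symm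
    · rw [Set.indicator_of_notMem hx]
      obtain ⟨i, hi⟩ : ∃ i, x i ∉ s i := by simpa using hx
      exact (Finset.prod_eq_zero (Finset.mem_univ i) (Set.indicator_of_notMem hi _)).symm
  have hmeas : MeasurableSet (Set.univ.pi s) := MeasurableSet.univ_pi hs
  rw [withDensity_apply _ hmeas,
    ← ofReal_integral_eq_lintegral_ofReal (Integrable.fintype_prod_dep hρ).integrableOn
      (ae_of_all _ fun x => Finset.prod_nonneg fun i _ => h0 i _),
    ← integral_indicator hmeas]
  simp_rw [hprod]
  rw [integral_fintype_prod_eq_prod, ENNReal.ofReal_prod_of_nonneg]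
  · refine Finset.prod_congr rfl fun i _ => ?_
    rw [withDensity_apply _ (hs i), integral_indicator (hs i),
      ofReal_integral_eq_lintegral_ofReal (hρ i).integrableOn (ae_of_all _ (h0 i))]
  · exact fun i _ => integral_nonneg fun x => Set.indicator_nonneg (fun x _ => h0 i x) x

/-- The density of `𝒩(a, v)` with respect to `𝒩(0, v)`. -/
noncomputable def gaussianTilt (v : ℝ) (a x : ℝ) : ℝ := Real.exp (a * x / v - a ^ 2 / (2 * v))

theorem gaussianReal_eq_withDensity_tilt {σ : ℝ} (hσ : 0 < σ) (a : ℝ) :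
    gaussianReal a (σ ^ 2).toNNReal = (gaussianReal 0 (σ ^ 2).toNNReal).withDensity
      fun x => ENNReal.ofReal (gaussianTilt (σ ^ 2) a x) := by
  have hv : (σ ^ 2).toNNReal ≠ 0 := by simpa using hσ.ne'
  have hc : (((σ ^ 2).toNNReal : NNReal) : ℝ) = σ ^ 2 := Real.coe_toNNReal _ (sq_nonneg σ)
  rw [gaussianReal_of_var_ne_zero _ hv, gaussianReal_of_var_ne_zero _ hv,
    ← withDensity_mul _ (measurable_gaussianPDF _ _)
      (by unfold gaussianTilt; fun_prop)]
  congr 1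
  ext x
  simp only [gaussianPDF, gaussianPDFReal, Pi.mul_apply, hc, gaussianTilt]
  rw [← ENNReal.ofReal_mul (by positivity), mul_assoc (√_)⁻¹, ← Real.exp_add]
  congr 3
  field_simp
  ring

theorem integrable_gaussianTilt {σ : ℝ} (hσ : 0 < σ) (a : ℝ) :
    Integrable (gaussianTilt (σ ^ 2) a) (gaussianReal 0 (σ ^ 2).toNNReal) := by
  refine ⟨(by unfold gaussianTilt; fun_prop), ?_⟩
  have h : (gaussianReal a (σ ^ 2).toNNReal) Set.univ = 1 := measure_univ
  rw [gaussianReal_eq_withDensity_tilt hσ, withDensity_apply _ MeasurableSet.univ,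
    Measure.restrict_univ] at h
  have h0 : ∀ x, 0 ≤ gaussianTilt (σ ^ 2) a x := fun x => (Real.exp_pos _).le
  rw [hasFiniteIntegral_iff_ofReal (ae_of_all _ h0), h]
  exact ENNReal.one_lt_top

/-- The density of the noise law translated by `θ` with respect to the noise law. -/
noncomputable def noiseTilt {N n : ℕ} (v : ℝ) (θ : Sym2 (Fin n) → ℝ)
    (w : Fin N → Sym2 (Fin n) → ℝ) : ℝ := ∏ l, ∏ s, gaussianTilt v (θ s) (w l s)

instance isProbabilityMeasure_noiseLaw (N n : ℕ) (σ : ℝ) :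
    IsProbabilityMeasure (noiseLaw N n σ) := by
  unfold noiseLaw; infer_instance

theorem map_noiseLaw {N n : ℕ} {σ : ℝ} (hσ : 0 < σ) (θ : Sym2 (Fin n) → ℝ) :
    (noiseLaw N n σ).map (fun w l => θ + w l) =
      (noiseLaw N n σ).withDensity fun w => ENNReal.ofReal (noiseTilt (σ ^ 2) θ w) := by
  set γ := gaussianReal 0 (σ ^ 2).toNNReal
  have h1 : (Measure.pi fun _ : Sym2 (Fin n) => γ).map (fun u => θ + u) =
      (Measure.pi fun _ : Sym2 (Fin n) => γ).withDensity
        fun u => ENNReal.ofReal (∏ s, gaussianTilt (σ ^ 2) (θ s) (u s)) := by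
    rw [← pi_withDensity_ofReal (fun _ => γ) (fun s => gaussianTilt (σ ^ 2) (θ s))
      (fun _ _ => (Real.exp_pos _).le) (fun s => integrable_gaussianTilt hσ (θ s))]
    simp_rw [γ, ← gaussianReal_eq_withDensity_tilt hσ]
    have := Measure.pi_map_pi (μ := fun _ : Sym2 (Fin n) => γ) (f := fun s x => θ s + x)
      (fun s => by fun_prop)
    simp only [γ, gaussianReal_map_const_add, zero_add] at this
    exact this
  have hint : Integrable (fun u : Sym2 (Fin n) → ℝ => ∏ s, gaussianTilt (σ ^ 2) (θ s) (u s))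
      (Measure.pi fun _ => γ) :=
    Integrable.fintype_prod_dep fun s => integrable_gaussianTilt hσ (θ s)
  have h2 := Measure.pi_map_pi (μ := fun _ : Fin N => Measure.pi fun _ : Sym2 (Fin n) => γ)
    (f := fun _ u => θ + u) (fun _ => by fun_prop)
  rw [h1] at h2
  rw [pi_withDensity_ofReal _ (fun _ (u : Sym2 (Fin n) → ℝ) =>
    ∏ s, gaussianTilt (σ ^ 2) (θ s) (u s))
    (fun _ _ => Finset.prod_nonneg fun _ _ => (Real.exp_pos _).le) (fun _ => hint)] at h2
  exact h2

theorem noiseTilt_pos {N n : ℕ} (v : ℝ) (θ : Sym2 (Fin n) → ℝ) (w : Fin N → Sym2 (Fin n) → ℝ) :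
    0 < noiseTilt v θ w :=
  Finset.prod_pos fun _ _ => Finset.prod_pos fun _ _ => Real.exp_pos _

@[fun_prop]
theorem measurable_noiseTilt {N n : ℕ} (v : ℝ) (θ : Sym2 (Fin n) → ℝ) :
    Measurable (noiseTilt (N := N) v θ) := by
  unfold noiseTilt gaussianTilt
  fun_prop

theorem measurable_translate {N n : ℕ} (θ : Sym2 (Fin n) → ℝ) :
    Measurable fun (w : Fin N → Sym2 (Fin n) → ℝ) l => θ + w l := by
  fun_prop

theorem integral_translate {N n : ℕ} {σ : ℝ} (hσ : 0 < σ) (θ : Sym2 (Fin n) → ℝ)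
    {F : (Fin N → Sym2 (Fin n) → ℝ) → ℝ} (hF : Measurable F) :
    ∫ w, F (fun l => θ + w l) ∂noiseLaw N n σ =
      ∫ w, noiseTilt (σ ^ 2) θ w * F w ∂noiseLaw N n σ := by
  refine (integral_map (φ := fun (w : Fin N → Sym2 (Fin n) → ℝ) l => θ + w l) (measurable_translate θ).aemeasurable
    hF.aestronglyMeasurable).symm.trans ?_
  rw [map_noiseLaw hσ,
    integral_withDensity_eq_integral_toReal_smul (by fun_prop) (by simp)]
  simp [ENNReal.toReal_ofReal (noiseTilt_pos _ _ _).le]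

theorem integrable_noiseTilt {N n : ℕ} {σ : ℝ} (hσ : 0 < σ) (θ : Sym2 (Fin n) → ℝ) :
    Integrable (noiseTilt (σ ^ 2) θ) (noiseLaw N n σ) := by
  refine ⟨(measurable_noiseTilt _ _).aestronglyMeasurable, ?_⟩
  have h : ((noiseLaw N n σ).map (fun w l => θ + w l)) Set.univ = 1 := by
    rw [Measure.map_apply (measurable_translate θ) MeasurableSet.univ]; simp
  rw [map_noiseLaw hσ, withDensity_apply _ MeasurableSet.univ, Measure.restrict_univ] at h
  rw [hasFiniteIntegral_iff_ofReal (ae_of_all _ fun x => (noiseTilt_pos _ _ _).le), h]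
  exact ENNReal.one_lt_top

theorem integral_noiseTilt {N n : ℕ} {σ : ℝ} (hσ : 0 < σ) (θ : Sym2 (Fin n) → ℝ) :
    ∫ w, noiseTilt (σ ^ 2) θ w ∂noiseLaw N n σ = 1 := by
  simpa using (integral_translate (N := N) hσ θ (F := fun _ => 1) measurable_const).symm

/-- Completing the square. Since every tilt integrates to one, second moments of mixtures of tilts
reduce to exponentials of inner products. -/
theorem noiseTilt_mul {N n : ℕ} {v : ℝ} (hv : v ≠ 0) (θ θ' : Sym2 (Fin n) → ℝ)
    (w : Fin N → Sym2 (Fin n) → ℝ) :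
    noiseTilt v θ w * noiseTilt v θ' w =
      Real.exp (∑ s, N * (θ s * θ' s) / v) * noiseTilt v (θ + θ') w := by
  have : Real.exp (∑ s, N * (θ s * θ' s) / v) =
      ∏ _l : Fin N, ∏ s, Real.exp (θ s * θ' s / v) := by
    simp only [Finset.prod_const, Finset.card_univ, Fintype.card_fin, ← Real.exp_sum,
      ← Real.exp_nat_mul, Finset.mul_sum]
    congr 1
    exact Finset.sum_congr rfl fun s _ => by ring
  rw [this]
  simp only [noiseTilt, ← Finset.prod_mul_distrib, gaussianTilt, ← Real.exp_add]
  refine Finset.prod_congr rfl fun l _ => Finset.prod_congr rfl fun s _ => ?_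
  congr 1
  simp only [Pi.add_apply]
  field_simp
  ring

theorem integrable_noiseTilt_mul {N n : ℕ} {σ : ℝ} (hσ : 0 < σ) (θ θ' : Sym2 (Fin n) → ℝ) :
    Integrable (fun w => noiseTilt (σ ^ 2) θ w * noiseTilt (σ ^ 2) θ' w) (noiseLaw N n σ) := by
  simp_rw [noiseTilt_mul (pow_ne_zero 2 hσ.ne')]
  exact (integrable_noiseTilt hσ _).const_mul _

theorem integral_noiseTilt_mul {N n : ℕ} {σ : ℝ} (hσ : 0 < σ) (θ θ' : Sym2 (Fin n) → ℝ) :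
    ∫ w, noiseTilt (σ ^ 2) θ w * noiseTilt (σ ^ 2) θ' w ∂noiseLaw N n σ =
      Real.exp (∑ s, N * (θ s * θ' s) / σ ^ 2) := by
  simp_rw [noiseTilt_mul (pow_ne_zero 2 hσ.ne')]
  rw [integral_const_mul, integral_noiseTilt hσ, mul_one]

/-! ### Testing against a mixture -/

/-- Lower bound on the Bayes risk of testing the noise law against a uniform mixture of its
translates, in terms of the second moment of the likelihood ratio. -/
theorem mixture_testing_lower_bound {N n : ℕ} {σ : ℝ} (hσ : 0 < σ) {κ : Type*} [Fintype κ]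
    [Nonempty κ] (A : κ → Sym2 (Fin n) → ℝ) {p M : ℝ} (hp0 : 0 < p) (hp1 : p < 1)
    (hM : ∑ k, ∑ k', Real.exp (∑ s, N * (A k s * A k' s) / σ ^ 2) ≤ (Fintype.card κ) ^ 2 * M)
    {g : (Fin N → Sym2 (Fin n) → ℝ) → ℝ} (hg : Measurable g) (hg01 : ∀ w, g w ∈ Set.Icc 0 1) :
    p * (1 - p * M / (4 * (1 - p))) ≤ (1 - p) * ∫ w, g w ∂noiseLaw N n σ +
      p * ((Fintype.card κ : ℝ)⁻¹ * ∑ k, ∫ w, (1 - g (fun l => A k + w l)) ∂noiseLaw N n σ) := by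
  set μ := noiseLaw N n σ
  set c : ℝ := (Fintype.card κ : ℝ)⁻¹ with hc
  have hcard : (0 : ℝ) < Fintype.card κ := by exact_mod_cast Fintype.card_pos
  have hc0 : 0 < c := inv_pos.2 hcard
  have hcc : c * Fintype.card κ = 1 := inv_mul_cancel₀ hcard.ne'
  set L : (Fin N → Sym2 (Fin n) → ℝ) → ℝ := fun w => c * ∑ k, noiseTilt (σ ^ 2) (A k) w with hL
  have hL0 : ∀ w, 0 ≤ L w := fun w =>
    mul_nonneg hc0.le (Finset.sum_nonneg fun k _ => (noiseTilt_pos _ _ _).le)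
  have hLi : Integrable L μ :=
    (integrable_finsetSum _ fun k _ => integrable_noiseTilt hσ (A k)).const_mul c
  have hL1 : ∫ w, L w ∂μ = 1 := by
    rw [hL, integral_const_mul, integral_finsetSum _ fun k _ => integrable_noiseTilt hσ (A k)]
    simp [integral_noiseTilt hσ, hcc]
  have hsq : ∀ w, L w ^ 2 = c ^ 2 * ∑ k, ∑ k', noiseTilt (σ ^ 2) (A k) w *
      noiseTilt (σ ^ 2) (A k') w := by
    intro w
    simp only [hL, mul_pow, sq (∑ k, _), Finset.sum_mul_sum]
  clear_value L
  have hL2i : Integrable (fun w => L w ^ 2) μ := by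
    simp_rw [hsq]
    exact (integrable_finsetSum _ fun k _ => integrable_finsetSum _ fun k' _ =>
      integrable_noiseTilt_mul hσ (A k) (A k')).const_mul _
  have hL2 : ∫ w, L w ^ 2 ∂μ ≤ M := by
    simp_rw [hsq]
    rw [integral_const_mul, integral_finsetSum _ fun k _ => integrable_finsetSum _ fun k' _ =>
      integrable_noiseTilt_mul hσ (A k) (A k')]
    have hk : ∀ k, ∫ w, ∑ k', noiseTilt (σ ^ 2) (A k) w * noiseTilt (σ ^ 2) (A k') w ∂μ =
        ∑ k', Real.exp (∑ s, N * (A k s * A k' s) / σ ^ 2) := fun k => by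
      rw [integral_finsetSum _ fun k' _ => integrable_noiseTilt_mul hσ (A k) (A k')]
      exact Finset.sum_congr rfl fun k' _ => integral_noiseTilt_mul hσ (A k) (A k')
    rw [Finset.sum_congr rfl fun k _ => hk k]
    calc c ^ 2 * _ ≤ c ^ 2 * ((Fintype.card κ) ^ 2 * M) := by gcongr
      _ = (c * Fintype.card κ) ^ 2 * M := by ring
      _ = M := by rw [hcc]; ring
  have hgi : Integrable g μ := by
    refine Integrable.of_bound hg.aestronglyMeasurable 1 (ae_of_all _ fun w => ?_)
    rw [Real.norm_eq_abs, abs_le]; constructor <;> linarith [(hg01 w).1, (hg01 w).2]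
  have hgLi : Integrable (fun w => L w * (1 - g w)) μ := by
    refine hLi.mono' (by fun_prop) (ae_of_all _ fun w => ?_)
    rw [Real.norm_eq_abs, abs_of_nonneg (mul_nonneg (hL0 w) (by linarith [(hg01 w).2]))]
    nlinarith [hL0 w, (hg01 w).1]
  have hti : ∀ k, Integrable (fun w => noiseTilt (σ ^ 2) (A k) w * (1 - g w)) μ := fun k => by
    refine (integrable_noiseTilt hσ (A k)).mono' (by fun_prop) (ae_of_all _ fun w => ?_)
    have := noiseTilt_pos (σ ^ 2) (A k) w
    rw [Real.norm_eq_abs, abs_of_nonneg (mul_nonneg this.le (by linarith [(hg01 w).2]))]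
    nlinarith [(hg01 w).1]
  have hmix : c * ∑ k, ∫ w, (1 - g (fun l => A k + w l)) ∂μ = ∫ w, L w * (1 - g w) ∂μ := by
    have hk : ∀ k, ∫ w, (1 - g (fun l => A k + w l)) ∂μ =
        ∫ w, noiseTilt (σ ^ 2) (A k) w * (1 - g w) ∂μ := fun k =>
      integral_translate hσ (A k) (F := fun w => 1 - g w) (by fun_prop)
    rw [Finset.sum_congr rfl fun k _ => hk k]
    rw [← integral_finsetSum _ fun k _ => hti k, ← integral_const_mul]
    simp only [hL, Finset.sum_mul, mul_assoc]
  rw [hmix, ← integral_const_mul, ← integral_const_mul, ← integral_add (hgi.const_mul _)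
    (hgLi.const_mul _)]
  have hq : 0 < 1 - p := by linarith
  -- The right side averages `1 - p` and `p L` with weights `g` and `1 - g`. Both dominate `p L - p²
  -- L² / (4 (1 - p))`: for `1 - p` this is a perfect square, for `p L` it is trivial.
  have hpt : ∀ w, p * (L w - p / (4 * (1 - p)) * L w ^ 2) ≤
      (1 - p) * g w + p * (L w * (1 - g w)) := by
    intro w
    obtain ⟨h0, h1⟩ := hg01 w
    have key : p * L w - (1 - p) ≤ p * (p / (4 * (1 - p)) * L w ^ 2) := by
      have : p * (p / (4 * (1 - p)) * L w ^ 2) - (p * L w - (1 - p)) =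
          (p * L w - 2 * (1 - p)) ^ 2 / (4 * (1 - p)) := by field_simp; ring
      have h2 : 0 ≤ (p * L w - 2 * (1 - p)) ^ 2 / (4 * (1 - p)) := by positivity
      linarith
    have key2 : 0 ≤ p * (p / (4 * (1 - p)) * L w ^ 2) := by positivity
    nlinarith
  refine le_trans ?_ (integral_mono ((hLi.sub (hL2i.const_mul _)).const_mul _)
    ((hgi.const_mul _).add (hgLi.const_mul _)) hpt)
  rw [integral_const_mul]
  have hsub : ∫ w, (L w - p / (4 * (1 - p)) * L w ^ 2) ∂μ =
      1 - p / (4 * (1 - p)) * ∫ w, L w ^ 2 ∂μ := by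
    rw [integral_sub hLi (hL2i.const_mul _), integral_const_mul, hL1]
  change _ ≤ p * ∫ w, (L w - p / (4 * (1 - p)) * L w ^ 2) ∂μ
  rw [hsub]
  have : p / (4 * (1 - p)) * ∫ w, L w ^ 2 ∂μ ≤ p / (4 * (1 - p)) * M := by gcongr
  have h3 : p * M / (4 * (1 - p)) = p / (4 * (1 - p)) * M := by ring
  rw [h3]
  gcongr

/-! ### Bernoulli random supports and the binomial tail -/

theorem sum_finset_eq_sum_erase_powerset {ι : Type*} [Fintype ι] [DecidableEq ι] (j : ι)
    (f : Finset ι → ℝ) :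
    ∑ S, f S = ∑ T ∈ (Finset.univ.erase j).powerset, (f T + f (insert j T)) := by
  rw [Finset.sum_add_distrib, ← Finset.sum_powerset_insert (Finset.notMem_erase j _),
    Finset.insert_erase (Finset.mem_univ j), Finset.powerset_univ]

/-- The probability of `S` when each index is selected independently with probability `p`. -/
noncomputable def bernoulliWeight {n : ℕ} (p : ℝ) (S : Finset (Fin n)) : ℝ :=
  p ^ S.card * (1 - p) ^ (n - S.card)

theorem bernoulliWeight_nonneg {n : ℕ} {p : ℝ} (h0 : 0 ≤ p) (h1 : p ≤ 1) (S : Finset (Fin n)) :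
    0 ≤ bernoulliWeight p S :=
  mul_nonneg (pow_nonneg h0 _) (pow_nonneg (by linarith) _)

theorem sum_bernoulliWeight (n : ℕ) (p : ℝ) :
    ∑ S : Finset (Fin n), bernoulliWeight p S = 1 := by
  simp only [bernoulliWeight]
  rw [Fin.sum_pow_mul_eq_add_pow]
  simp

theorem card_le_of_mem_powerset_erase {n : ℕ} {j : Fin n} {T : Finset (Fin n)}
    (hT : T ∈ (Finset.univ.erase j).powerset) : j ∉ T ∧ T.card ≤ n - 1 := by
  rw [Finset.mem_powerset] at hT
  refine ⟨fun h => Finset.notMem_erase j _ (hT h), (Finset.card_le_card hT).trans ?_⟩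
  simp [Finset.card_erase_of_mem]

/-- Size-biasing: count pairs `j ∈ S`, then remove `j` and apply the binomial theorem to the
remaining `n - 1` indices. -/
theorem sum_card_mul_pow (n : ℕ) (a b : ℝ) :
    ∑ S : Finset (Fin n), (S.card : ℝ) * (a ^ S.card * b ^ (n - S.card)) =
      n * (a * (a + b) ^ (n - 1)) := by
  have h1 : ∀ S : Finset (Fin n), (S.card : ℝ) * (a ^ S.card * b ^ (n - S.card)) =
      ∑ j, if j ∈ S then a ^ S.card * b ^ (n - S.card) else 0 := by
    intro S
    rw [← Finset.sum_filter]
    simp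
  simp_rw [h1]
  rw [Finset.sum_comm]
  have h2 : ∀ j : Fin n, (∑ S : Finset (Fin n),
      if j ∈ S then a ^ S.card * b ^ (n - S.card) else 0) = a * (a + b) ^ (n - 1) := by
    intro j
    rw [sum_finset_eq_sum_erase_powerset j]
    have hc : (Finset.univ.erase j).card = n - 1 := by simp [Finset.card_erase_of_mem]
    rw [← hc, ← Finset.sum_pow_mul_eq_add_pow, Finset.mul_sum, hc]
    refine Finset.sum_congr rfl fun T hT => ?_
    obtain ⟨hj, hle⟩ := card_le_of_mem_powerset_erase hT
    rw [if_neg hj, if_pos (Finset.mem_insert_self j T), Finset.card_insert_of_notMem hj,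
      pow_succ, show n - (T.card + 1) = n - 1 - T.card by omega]
    ring
  simp [h2]

theorem sum_bernoulliWeight_card_gt_le (n m : ℕ) {p l : ℝ} (h0 : 0 ≤ p) (h1 : p ≤ 1)
    (hl : 0 ≤ l) :
    ∑ S : Finset (Fin n), (if m < S.card then bernoulliWeight p S * S.card else 0) ≤
      n * p * Real.exp (n * p * (Real.exp l - 1) - l * m) := by
  have hq : 0 ≤ 1 - p := by linarith
  have h2 : ∀ S : Finset (Fin n), (if m < S.card then bernoulliWeight p S * S.card else 0) ≤
      Real.exp (-(l * (m + 1))) *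
        ((S.card : ℝ) * ((p * Real.exp l) ^ S.card * (1 - p) ^ (n - S.card))) := by
    intro S
    split_ifs with h
    -- Integrality gives `m + 1 ≤ |S|`; the extra `exp (-l)` later cancels the `exp l` produced by
    -- size-biasing.
    · have h3 : 1 ≤ Real.exp (-(l * (m + 1))) * Real.exp l ^ S.card := by
        rw [← Real.exp_nat_mul, ← Real.exp_add]
        apply Real.one_le_exp
        have : (m : ℝ) + 1 ≤ S.card := by exact_mod_cast h
        nlinarith
      have h4 : 0 ≤ bernoulliWeight p S * S.card :=
        mul_nonneg (bernoulliWeight_nonneg h0 h1 S) (Nat.cast_nonneg _)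
      calc bernoulliWeight p S * S.card
          ≤ (Real.exp (-(l * (m + 1))) * Real.exp l ^ S.card) *
              (bernoulliWeight p S * S.card) := le_mul_of_one_le_left h4 h3
        _ = _ := by rw [bernoulliWeight, mul_pow]; ring
    · positivity
  refine (Finset.sum_le_sum fun S _ => h2 S).trans ?_
  rw [← Finset.mul_sum, sum_card_mul_pow]
  have hel : 1 ≤ Real.exp l := Real.one_le_exp hl
  have h5 : p * Real.exp l + (1 - p) ≤ Real.exp (p * (Real.exp l - 1)) := by
    linarith [Real.add_one_le_exp (p * (Real.exp l - 1))]
  have h6 : (p * Real.exp l + (1 - p)) ^ (n - 1) ≤ Real.exp (n * p * (Real.exp l - 1)) := by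
    refine (pow_le_pow_left₀ (by positivity) h5 _).trans ?_
    rw [← Real.exp_nat_mul]
    apply Real.exp_le_exp.2
    have : ((n - 1 : ℕ) : ℝ) ≤ n := by exact_mod_cast Nat.sub_le n 1
    rw [mul_assoc]
    exact mul_le_mul_of_nonneg_right this (mul_nonneg h0 (by linarith))
  calc Real.exp (-(l * (m + 1))) * (n * (p * Real.exp l * (p * Real.exp l + (1 - p)) ^ (n - 1)))
      = n * p * ((Real.exp (-(l * (m + 1))) * Real.exp l) *
          (p * Real.exp l + (1 - p)) ^ (n - 1)) := by ring
    _ ≤ n * p * ((Real.exp (-(l * (m + 1))) * Real.exp l) *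
          Real.exp (n * p * (Real.exp l - 1))) := by gcongr
    _ = _ := by
      rw [← Real.exp_add, ← Real.exp_add]
      congr 2
      ring

/-- Keep two terms of the nonnegative series for `-log (1 - x)` at `x = 1 - u`. The quadratic term
becomes the exponent of the Chernoff bound. -/
theorem log_le_quadratic {u : ℝ} (h0 : 0 < u) (h1 : u ≤ 1) :
    Real.log u ≤ (u - 1) - (1 - u) ^ 2 / 2 := by
  have h := Real.hasSum_pow_div_log_of_abs_lt_one (x := 1 - u)
    (by rw [abs_of_nonneg (by linarith)]; linarith)
  have h2 := sum_le_hasSum (Finset.range 2)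
    (fun k _ => div_nonneg (pow_nonneg (by linarith : 0 ≤ 1 - u) _) (by positivity)) h
  simp only [Finset.sum_range_succ, Finset.sum_range_zero, sub_sub_cancel] at h2
  norm_num at h2
  linarith

/-- Chernoff bound for the mean of the part of a binomial variable exceeding `m`. -/
theorem sum_bernoulliWeight_card_gt_le_exp {n m : ℕ} {m' : ℝ} (hn : 0 < n) (h0 : 0 < m')
    (h1 : m' ≤ m) (h2 : m' ≤ n) :
    ∑ S : Finset (Fin n), (if m < S.card then bernoulliWeight (m' / n) S * S.card else 0) ≤
      m' * Real.exp (-((m - m') ^ 2 / (2 * m))) := by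
  have hn' : (0 : ℝ) < n := by exact_mod_cast hn
  have hm : (0 : ℝ) < m := h0.trans_le h1
  have hlog := log_le_quadratic (div_pos h0 hm) ((div_le_one hm).2 h1)
  have hl : Real.log (m / m') = -Real.log (m' / m) := by rw [← Real.log_inv, inv_div]
  -- The optimal tilt: `exp l = m / m'` minimizes `m' (exp l - 1) - l m`.
  refine (sum_bernoulliWeight_card_gt_le n m (l := Real.log (m / m')) (by positivity)
    ((div_le_one hn').2 h2) (Real.log_nonneg ((one_le_div h0).2 h1))).trans ?_
  rw [mul_div_cancel₀ _ hn'.ne', Real.exp_log (by positivity)]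
  refine mul_le_mul_of_nonneg_left (Real.exp_le_exp.2 ?_) h0.le
  rw [hl]
  have h3 := mul_le_mul_of_nonneg_left hlog hm.le
  have h4 : (m : ℝ) * (m' / m - 1 - (1 - m' / m) ^ 2 / 2) =
      m' - m - (m - m') ^ 2 / (2 * m) := by field_simp
  have h5 : m' * ((m : ℝ) / m' - 1) = m - m' := by field_simp
  rw [h5]
  linarith

/-! ### Randomly signed signals -/

open Classical in
/-- The signal `±b` on the entries whose row or column lies in `S`, with signs `ε`. -/
noncomputable def signedSignal {n : ℕ} (b : ℝ) (S : Finset (Fin n)) (ε : Sym2 (Fin n) → ℤˣ)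
    (s : Sym2 (Fin n)) : ℝ := if ∃ i ∈ S, i ∈ s then b * ((ε s : ℤ) : ℝ) else 0

theorem abs_unitsInt_cast (u : ℤˣ) : |((u : ℤ) : ℝ)| = 1 := by
  rcases Int.units_eq_one_or u with rfl | rfl <;> simp

theorem abs_signedSignal {n : ℕ} {b : ℝ} (hb : 0 < b) {S : Finset (Fin n)}
    (ε : Sym2 (Fin n) → ℤˣ) {i : Fin n} (hi : i ∈ S) (j : Fin n) :
    |noiseMatrix (signedSignal b S ε) i j| = b := by
  have h : ∃ k ∈ S, k ∈ s(i, j) := ⟨i, hi, Sym2.mem_mk_left i j⟩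
  simp only [noiseMatrix, Matrix.of_apply, signedSignal, if_pos h]
  rw [abs_mul, abs_unitsInt_cast, abs_of_pos hb, mul_one]

theorem noiseMatrix_isSymm {n : ℕ} (θ : Sym2 (Fin n) → ℝ) : (noiseMatrix θ).IsSymm := by
  ext i j
  simp [noiseMatrix, Sym2.eq_swap]

/-- Nonzero diagonal entries force every admissible index set to contain `S`, and `S` itself is
admissible. -/
theorem nodeSupport_signedSignal {n : ℕ} {b : ℝ} (hb : 0 < b) (S : Finset (Fin n))
    (ε : Sym2 (Fin n) → ℤˣ) : nodeSupport (noiseMatrix (signedSignal b S ε)) = S := by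
  set B := noiseMatrix (signedSignal b S ε) with hBdef
  have hB : B.IsSymm := noiseMatrix_isSymm _
  have habs : ∀ i ∈ S, ∀ j, |B i j| = b := fun i hi j => abs_signedSignal hb ε hi j
  obtain ⟨⟨-, hzero⟩, hmin⟩ := isNodeSupport_nodeSupport hB
  have hsub : S ⊆ nodeSupport B := by
    intro i hi
    by_contra h
    have h1 := habs i hi i
    rw [hzero i h i h, abs_zero] at h1
    exact hb.ne h1
  refine (Finset.eq_of_subset_of_card_le hsub (hmin S ⟨fun i hi => ⟨?_, ?_⟩, ?_⟩)).symm
  · simp only [hB.apply]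
  · rw [Real.sqrt_pos]
    refine Finset.sum_pos' (fun _ _ => sq_nonneg _) ⟨i, Finset.mem_univ i, ?_⟩
    rw [← sq_abs, habs i hi i]
    positivity
  · intro i hi j hj
    simp only [hBdef, noiseMatrix, Matrix.of_apply, signedSignal, Sym2.mem_iff]
    rw [if_neg]
    rintro ⟨k, hk, rfl | rfl⟩
    exacts [hi hk, hj hk]

theorem signedSignal_mem_restrictedClass {n m : ℕ} {b β : ℝ} (hb : 0 < b) (hβ : β ≤ b)
    {S : Finset (Fin n)} (hS : S.card ≤ m) (ε : Sym2 (Fin n) → ℤˣ) :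
    noiseMatrix (signedSignal b S ε) ∈ restrictedClass β n m := by
  have hB := noiseMatrix_isSymm (signedSignal b S ε)
  refine ⟨hB, ?_, ?_, (isNodeSupport_nodeSupport hB).1.2⟩
  · rwa [nodeSupport_signedSignal hb]
  · rw [nodeSupport_signedSignal hb]
    exact fun i hi j _ => hβ.trans (abs_signedSignal hb ε hi j).ge

/-- For fixed `ε` the sum over `ε'` factorizes over entries, each entry of `V` contributing `2 cosh
c ≤ 2 exp (c² / 2)`. -/
theorem sum_signs_exp_le {ι : Type*} [Fintype ι] [DecidableEq ι] (V : Finset ι) {n : ℕ}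
    (hV : V.card ≤ n) (c : ℝ) :
    ∑ ε : ι → ℤˣ, ∑ ε' : ι → ℤˣ,
        Real.exp (∑ s, if s ∈ V then c * (((ε s : ℤ) : ℝ) * ((ε' s : ℤ) : ℝ)) else 0) ≤
      (Fintype.card (ι → ℤˣ) : ℝ) ^ 2 * Real.exp (n * (c ^ 2 / 2)) := by
  have h1 : ∀ ε : ι → ℤˣ, ∑ ε' : ι → ℤˣ,
      Real.exp (∑ s, if s ∈ V then c * (((ε s : ℤ) : ℝ) * ((ε' s : ℤ) : ℝ)) else 0) ≤
        (Fintype.card (ι → ℤˣ) : ℝ) * Real.exp (n * (c ^ 2 / 2)) := by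
    intro ε
    simp_rw [Real.exp_sum]
    have h2 := Finset.prod_univ_sum (fun _ : ι => (Finset.univ : Finset ℤˣ)) (fun s u =>
      Real.exp (if s ∈ V then c * (((ε s : ℤ) : ℝ) * ((u : ℤ) : ℝ)) else 0))
    rw [Fintype.piFinset_univ] at h2
    rw [← h2]
    have h3 : ∀ s, ∑ u : ℤˣ,
        Real.exp (if s ∈ V then c * (((ε s : ℤ) : ℝ) * ((u : ℤ) : ℝ)) else 0) ≤
          2 * (if s ∈ V then Real.exp (c ^ 2 / 2) else 1) := by
      intro s
      by_cases hs : s ∈ V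
      · have h4 := Real.cosh_le_exp_half_sq c
        rw [Real.cosh_eq] at h4
        rcases Int.units_eq_one_or (ε s) with h | h <;>
          simp [hs, h, UnitsInt.univ] <;> linarith
      · simp [hs]
    refine (Finset.prod_le_prod (fun s _ => Finset.sum_nonneg fun _ _ => (Real.exp_pos _).le)
      fun s _ => h3 s).trans ?_
    rw [Finset.prod_mul_distrib, Finset.prod_ite_mem, Finset.univ_inter, Finset.prod_const,
      Finset.prod_const, ← Real.exp_nat_mul]
    have h5 : (Fintype.card (ι → ℤˣ) : ℝ) = 2 ^ (Finset.univ : Finset ι).card := by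
      simp
    rw [h5]
    gcongr
  refine (Finset.sum_le_sum fun ε _ => h1 ε).trans ?_
  rw [Finset.sum_const, Finset.card_univ, nsmul_eq_mul]
  exact le_of_eq (by ring)

open Classical in
/-- The entries in row or column `j` outside the rows and columns indexed by `T`. -/
noncomputable def freshEntries {n : ℕ} (T : Finset (Fin n)) (j : Fin n) :
    Finset (Sym2 (Fin n)) :=
  Finset.univ.filter fun s => j ∈ s ∧ ¬∃ i ∈ T, i ∈ s

theorem card_freshEntries_le {n : ℕ} (T : Finset (Fin n)) (j : Fin n) :
    (freshEntries T j).card ≤ n := by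
  classical
  have h : freshEntries T j ⊆ Finset.univ.image fun k => s(j, k) := by
    intro s hs
    obtain ⟨k, rfl⟩ := (Finset.mem_filter.1 hs).2.1
    exact Finset.mem_image_of_mem _ (Finset.mem_univ k)
  exact (Finset.card_le_card h).trans (Finset.card_image_le.trans (by simp))

open Classical in
/-- The sign pattern `ε'` on the fresh entries, extended by `1`. -/
noncomputable def freshSigns {n : ℕ} (T : Finset (Fin n)) (j : Fin n)
    (ε' : Sym2 (Fin n) → ℤˣ) (s : Sym2 (Fin n)) : ℤˣ := if s ∈ freshEntries T j then ε' s else 1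

open Classical in
-- Multiplying `ε` by fresh signs leaves the signal on `T` unchanged and randomizes only what `j`
-- adds. Being a group translation, it preserves the uniform law of `ε`.
theorem signedSignal_insert {n : ℕ} (b : ℝ) (T : Finset (Fin n)) (j : Fin n)
    (ε ε' : Sym2 (Fin n) → ℤˣ) :
    signedSignal b (insert j T) (ε * freshSigns T j ε') = signedSignal b T ε +
      fun s => if s ∈ freshEntries T j then b * (((ε s : ℤ) : ℝ) * ((ε' s : ℤ) : ℝ)) else 0 := by
  ext s
  by_cases hT : ∃ i ∈ T, i ∈ s
  · have h1 : ∃ i ∈ insert j T, i ∈ s := by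
      obtain ⟨i, hi, his⟩ := hT
      exact ⟨i, Finset.mem_insert_of_mem hi, his⟩
    have h2 : s ∉ freshEntries T j := fun h => (Finset.mem_filter.1 h).2.2 hT
    simp only [signedSignal, if_pos h1, if_pos hT, Pi.add_apply, if_neg h2, freshSigns,
      Pi.mul_apply, mul_one, add_zero]
  · by_cases hj : j ∈ s
    · have h1 : ∃ i ∈ insert j T, i ∈ s := ⟨j, Finset.mem_insert_self j T, hj⟩
      have h2 : s ∈ freshEntries T j := Finset.mem_filter.2 ⟨Finset.mem_univ s, hj, hT⟩
      simp only [signedSignal, if_pos h1, if_neg hT, Pi.add_apply, if_pos h2, freshSigns,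
        Pi.mul_apply]
      push_cast
      ring
    · have h1 : ¬∃ i ∈ insert j T, i ∈ s := by
        rintro ⟨i, hi, his⟩
        rcases Finset.mem_insert.1 hi with rfl | hi
        exacts [hj his, hT ⟨i, hi, his⟩]
      have h2 : s ∉ freshEntries T j := fun h => hj (Finset.mem_filter.1 h).2.1
      simp only [signedSignal, if_neg h1, if_neg hT, Pi.add_apply, if_neg h2, add_zero]

/-! ### Sign averages and the Bayes risk -/

/-- The average of `f` over all sign patterns. -/
noncomputable def signAverage {n : ℕ} (f : (Sym2 (Fin n) → ℤˣ) → ℝ) : ℝ :=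
  (Fintype.card (Sym2 (Fin n) → ℤˣ) : ℝ)⁻¹ * ∑ ε, f ε

theorem signAverage_mono {n : ℕ} {f g : (Sym2 (Fin n) → ℤˣ) → ℝ} (h : ∀ ε, f ε ≤ g ε) :
    signAverage f ≤ signAverage g :=
  mul_le_mul_of_nonneg_left (Finset.sum_le_sum fun ε _ => h ε) (by positivity)

theorem signAverage_const (n : ℕ) (a : ℝ) :
    signAverage (fun _ : Sym2 (Fin n) → ℤˣ => a) = a := by
  have h : (Fintype.card (Sym2 (Fin n) → ℤˣ) : ℝ) ≠ 0 := by
    exact_mod_cast Fintype.card_ne_zero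
  rw [signAverage, Finset.sum_const, Finset.card_univ, nsmul_eq_mul, inv_mul_cancel_left₀ h]

theorem signAverage_add {n : ℕ} (f g : (Sym2 (Fin n) → ℤˣ) → ℝ) :
    signAverage (fun ε => f ε + g ε) = signAverage f + signAverage g := by
  simp only [signAverage, Finset.sum_add_distrib, mul_add]

theorem signAverage_const_mul {n : ℕ} (a : ℝ) (f : (Sym2 (Fin n) → ℤˣ) → ℝ) :
    signAverage (fun ε => a * f ε) = a * signAverage f := by
  simp only [signAverage, ← Finset.mul_sum]
  ring

theorem signAverage_sum {n : ℕ} {κ : Type*} (t : Finset κ)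
    (f : κ → (Sym2 (Fin n) → ℤˣ) → ℝ) :
    signAverage (fun ε => ∑ k ∈ t, f k ε) = ∑ k ∈ t, signAverage (f k) := by
  simp only [signAverage, ← Finset.mul_sum]
  rw [Finset.sum_comm]

theorem signAverage_comm {n : ℕ} (f : (Sym2 (Fin n) → ℤˣ) → (Sym2 (Fin n) → ℤˣ) → ℝ) :
    signAverage (fun ε => signAverage (f ε)) =
      signAverage (fun ε' => signAverage fun ε => f ε ε') := by
  simp only [signAverage, ← Finset.mul_sum]
  rw [Finset.sum_comm]

theorem signAverage_mul_right {n : ℕ} (f : (Sym2 (Fin n) → ℤˣ) → ℝ)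
    (χ : Sym2 (Fin n) → ℤˣ) : signAverage (fun ε => f (ε * χ)) = signAverage f := by
  simp only [signAverage]
  rw [← Equiv.sum_comp (Equiv.mulRight χ) f]
  rfl

open Classical in
/-- Deciding whether `j` belongs to the support, given the rest `T` of the support. -/
theorem coordinate_testing_lower_bound {N n : ℕ} {σ b p : ℝ} (hσ : 0 < σ) (hp0 : 0 < p)
    (hp1 : p < 1) {g : (Fin N → Sym2 (Fin n) → ℝ) → ℝ} (hg : Measurable g)
    (hg01 : ∀ w, g w ∈ Set.Icc 0 1) (T : Finset (Fin n)) (j : Fin n) :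
    p * (1 - p * Real.exp (n * ((N * b ^ 2 / σ ^ 2) ^ 2 / 2)) / (4 * (1 - p))) ≤
      (1 - p) * signAverage (fun ε => ∫ w, g (fun l => signedSignal b T ε + w l)
          ∂noiseLaw N n σ) +
      p * signAverage (fun ε => ∫ w, (1 - g (fun l => signedSignal b (insert j T) ε + w l))
          ∂noiseLaw N n σ) := by
  set lhs := p * (1 - p * Real.exp (n * ((N * b ^ 2 / σ ^ 2) ^ 2 / 2)) / (4 * (1 - p)))
  set F : (Sym2 (Fin n) → ℤˣ) → ℝ := fun ε =>
    ∫ w, (1 - g (fun l => signedSignal b (insert j T) ε + w l)) ∂noiseLaw N n σ with hF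
  set G : (Sym2 (Fin n) → ℤˣ) → ℝ := fun ε =>
    ∫ w, g (fun l => signedSignal b T ε + w l) ∂noiseLaw N n σ
  -- With `ε` fixed, the signal on `T` is a known shift absorbed into the test, so only the fresh
  -- signs are mixed.
  have key : ∀ ε, lhs ≤ (1 - p) * G ε +
      p * signAverage fun ε' => F (ε * freshSigns T j ε') := by
    intro ε
    set A : (Sym2 (Fin n) → ℤˣ) → Sym2 (Fin n) → ℝ := fun ε' s =>
      if s ∈ freshEntries T j then b * (((ε s : ℤ) : ℝ) * ((ε' s : ℤ) : ℝ)) else 0 with hA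
    have hM : ∑ k, ∑ k', Real.exp (∑ s, N * (A k s * A k' s) / σ ^ 2) ≤
        (Fintype.card (Sym2 (Fin n) → ℤˣ) : ℝ) ^ 2 *
          Real.exp (n * ((N * b ^ 2 / σ ^ 2) ^ 2 / 2)) := by
      refine le_of_eq_of_le ?_ (sum_signs_exp_le (freshEntries T j) (card_freshEntries_le T j)
        (N * b ^ 2 / σ ^ 2))
      refine Finset.sum_congr rfl fun k _ => Finset.sum_congr rfl fun k' _ => ?_
      congr 1
      refine Finset.sum_congr rfl fun s _ => ?_
      have hsq : ((ε s : ℤ) : ℝ) * ((ε s : ℤ) : ℝ) = 1 := by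
        rw [← abs_mul_abs_self, abs_unitsInt_cast, one_mul]
      by_cases hs : s ∈ freshEntries T j
      · simp only [hA, if_pos hs]
        linear_combination
          (N * b ^ 2 / σ ^ 2 * (((k s : ℤ) : ℝ) * ((k' s : ℤ) : ℝ))) * hsq
      · simp [hA, hs]
    have h := mixture_testing_lower_bound hσ A hp0 hp1 hM
      (g := fun w => g fun l => signedSignal b T ε + w l)
      (hg.comp (measurable_translate _)) (fun w => hg01 _)
    refine h.trans (le_of_eq ?_)
    simp only [hF, signAverage, signedSignal_insert, add_assoc]
    rfl
  have h2 := signAverage_mono key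
  rw [signAverage_const, signAverage_add, signAverage_const_mul, signAverage_const_mul,
    signAverage_comm] at h2
  -- After the averages are exchanged, translation invariance in `ε` removes the dependence on `ε'`.
  simp_rw [signAverage_mul_right F] at h2
  rwa [signAverage_const] at h2

open Classical in
/-- The error of the estimator `g` for the indicator of `S` at the coordinate `j`, averaged over
the signs of the signal. -/
noncomputable def coordinateRisk {N n : ℕ} (σ b : ℝ)
    (g : (Fin N → Sym2 (Fin n) → ℝ) → Fin n → ℝ) (S : Finset (Fin n)) (j : Fin n) : ℝ :=
  signAverage fun ε => ∫ w, |(if j ∈ S then 1 else 0) - g (fun l => signedSignal b S ε + w l) j|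
    ∂noiseLaw N n σ

/-- Lower bound on the Bayes risk when the support is selected by independent coin tosses. -/
theorem bayes_risk_lower_bound {N n : ℕ} {σ b p : ℝ} (hσ : 0 < σ) (hp0 : 0 < p)
    (hp1 : p < 1) {g : (Fin N → Sym2 (Fin n) → ℝ) → Fin n → ℝ} (hg : Measurable g)
    (hg01 : ∀ w i, g w i ∈ Set.Icc 0 1) :
    n * (p * (1 - p * Real.exp (n * ((N * b ^ 2 / σ ^ 2) ^ 2 / 2)) / (4 * (1 - p)))) ≤
      ∑ S, bernoulliWeight p S * ∑ j, coordinateRisk σ b g S j := by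
  classical
  set lhs := p * (1 - p * Real.exp (n * ((N * b ^ 2 / σ ^ 2) ^ 2 / 2)) / (4 * (1 - p)))
  simp_rw [Finset.mul_sum]
  rw [Finset.sum_comm]
  have hj : ∀ j : Fin n, lhs ≤ ∑ S, bernoulliWeight p S * coordinateRisk σ b g S j := by
    intro j
    have hc : (Finset.univ.erase j).card = n - 1 := by simp [Finset.card_erase_of_mem]
    have h1 : ∑ T ∈ (Finset.univ.erase j).powerset, p ^ T.card * (1 - p) ^ (n - 1 - T.card) = 1 := by
      rw [← hc, Finset.sum_pow_mul_eq_add_pow]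
      simp
    -- The weights of `T` and `insert j T` are a common factor times `1 - p` and `p`, and these
    -- factors sum to one over `T`.
    rw [sum_finset_eq_sum_erase_powerset j, ← one_mul lhs, ← h1, Finset.sum_mul]
    refine Finset.sum_le_sum fun T hT => ?_
    obtain ⟨hjT, hle⟩ := card_le_of_mem_powerset_erase hT
    have hn : 0 < n := j.pos
    have h := coordinate_testing_lower_bound (N := N) (b := b) hσ hp0 hp1
      (g := fun w => g w j) (by fun_prop) (fun w => hg01 w j) T j
    have e1 : coordinateRisk σ b g T j = signAverage fun ε =>
        ∫ w, g (fun l => signedSignal b T ε + w l) j ∂noiseLaw N n σ := by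
      simp only [coordinateRisk, if_neg hjT, zero_sub, abs_neg]
      simp_rw [abs_of_nonneg (hg01 _ j).1]
    have e2 : coordinateRisk σ b g (insert j T) j = signAverage fun ε =>
        ∫ w, (1 - g (fun l => signedSignal b (insert j T) ε + w l) j) ∂noiseLaw N n σ := by
      simp only [coordinateRisk, if_pos (Finset.mem_insert_self j T)]
      simp_rw [abs_of_nonneg (sub_nonneg.2 (hg01 _ j).2)]
    rw [← e1, ← e2] at h
    have hw : 0 ≤ p ^ T.card * (1 - p) ^ (n - 1 - T.card) :=
      mul_nonneg (pow_nonneg hp0.le _) (pow_nonneg (by linarith) _)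
    refine (mul_le_mul_of_nonneg_left h hw).trans (le_of_eq ?_)
    rw [bernoulliWeight, bernoulliWeight, Finset.card_insert_of_notMem hjT,
      show n - (T.card + 1) = n - 1 - T.card by omega,
      show n - T.card = n - 1 - T.card + 1 by omega]
    ring
  calc (n : ℝ) * lhs = ∑ _j : Fin n, lhs := by simp
    _ ≤ _ := Finset.sum_le_sum fun j _ => hj j

/-! ### Truncating the estimator -/

/-- The observations as a function of the free entries of the noise, for the symmetric signal with
free entries `θ`. -/
theorem observations_noiseMatrix {N n : ℕ} (θ : Sym2 (Fin n) → ℝ)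
    (w : Fin N → Sym2 (Fin n) → ℝ) :
    observations (noiseMatrix θ) w = fun l i j => (θ + w l) s(i, j) := rfl

open Classical in
/-- The estimator `e`, as a function of the free entries of the observations, set to zero when it
selects more than `2m` indices. -/
noncomputable def truncatedEstimator {N n : ℕ} (m : ℕ)
    (e : (Fin N → Fin n → Fin n → ℝ) → Fin n → ℝ) (y : Fin N → Sym2 (Fin n) → ℝ) (i : Fin n) : ℝ :=
  if ∑ k, e (fun l i j => y l s(i, j)) k ≤ 2 * m then e (fun l i j => y l s(i, j)) i else 0

theorem measurable_truncatedEstimator {N n : ℕ} (m : ℕ)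
    {e : (Fin N → Fin n → Fin n → ℝ) → Fin n → ℝ} (he : Measurable e) :
    Measurable (truncatedEstimator m e) := by
  have h1 : Measurable fun (y : Fin N → Sym2 (Fin n) → ℝ) => e fun l i j => y l s(i, j) :=
    he.comp (by fun_prop)
  refine measurable_pi_lambda _ fun i => ?_
  refine Measurable.ite (measurableSet_le ?_ measurable_const) ?_ measurable_const
  · fun_prop
  · fun_prop

theorem truncatedEstimator_mem_Icc {N n : ℕ} (m : ℕ)
    {e : (Fin N → Fin n → Fin n → ℝ) → Fin n → ℝ} (he : ∀ y i, e y i ∈ Set.Icc (0 : ℝ) 1)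
    (y : Fin N → Sym2 (Fin n) → ℝ) (i : Fin n) : truncatedEstimator m e y i ∈ Set.Icc (0 : ℝ) 1 := by
  unfold truncatedEstimator
  split_ifs
  exacts [he _ _, by simp]

open Classical in
-- If the estimator has total mass above `2m`, its loss exceeds `2m - |S| ≥ m`, whereas the zero
-- vector loses only `|S| ≤ m`.
theorem hammingLoss_truncatedEstimator_le {N n m : ℕ}
    {e : (Fin N → Fin n → Fin n → ℝ) → Fin n → ℝ}
    {S : Finset (Fin n)} (hS : S.card ≤ m) (y : Fin N → Sym2 (Fin n) → ℝ) :
    hammingLoss (fun j => if j ∈ S then 1 else 0) (truncatedEstimator m e y) ≤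
      hammingLoss (fun j => if j ∈ S then 1 else 0) (e fun l i j => y l s(i, j)) := by
  by_cases h : ∑ k, e (fun l i j => y l s(i, j)) k ≤ 2 * m
  · refine le_of_eq (congrArg _ (funext fun i => ?_))
    rw [truncatedEstimator, if_pos h]
  · simp only [hammingLoss, truncatedEstimator, if_neg h]
    have h1 : ∑ j, |(if j ∈ S then (1 : ℝ) else 0) - 0| = S.card := by
      simp [apply_ite abs]
    have h2 : ∑ j, (e (fun l i j => y l s(i, j)) j - if j ∈ S then (1 : ℝ) else 0) ≤
        ∑ j, |(if j ∈ S then (1 : ℝ) else 0) - e (fun l i j => y l s(i, j)) j| :=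
      Finset.sum_le_sum fun j _ => by
        rw [abs_sub_comm]
        exact le_abs_self _
    rw [Finset.sum_sub_distrib] at h2
    have h3 : ∑ j, (if j ∈ S then (1 : ℝ) else 0) = S.card := by simp
    have h4 : (S.card : ℝ) ≤ m := by exact_mod_cast hS
    rw [h1]
    linarith [not_le.1 h]

open Classical in
-- The loss is at most the sum of the two masses, `|S| + 2m`.
theorem hammingLoss_truncatedEstimator_le_of_lt {N n m : ℕ}
    {e : (Fin N → Fin n → Fin n → ℝ) → Fin n → ℝ} (he : ∀ y i, e y i ∈ Set.Icc (0 : ℝ) 1)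
    {S : Finset (Fin n)} (hS : m < S.card) (y : Fin N → Sym2 (Fin n) → ℝ) :
    hammingLoss (fun j => if j ∈ S then 1 else 0) (truncatedEstimator m e y) ≤ 3 * S.card := by
  have h1 : ∑ j, truncatedEstimator m e y j ≤ 2 * m := by
    by_cases h : ∑ k, e (fun l i j => y l s(i, j)) k ≤ 2 * m
    · simpa only [truncatedEstimator, if_pos h] using h
    · simp only [truncatedEstimator, if_neg h, Finset.sum_const_zero]
      positivity
  have h2 : hammingLoss (fun j => if j ∈ S then 1 else 0) (truncatedEstimator m e y) ≤
      ∑ j, ((if j ∈ S then (1 : ℝ) else 0) + truncatedEstimator m e y j) := by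
    refine Finset.sum_le_sum fun j _ => ?_
    have h0 := (truncatedEstimator_mem_Icc m he y j).1
    beta_reduce
    split_ifs <;> rw [abs_le] <;> constructor <;> linarith
  rw [Finset.sum_add_distrib] at h2
  have h3 : ∑ j, (if j ∈ S then (1 : ℝ) else 0) = S.card := by simp
  have h4 : (m : ℝ) ≤ S.card := by exact_mod_cast hS.le
  linarith

theorem measurable_hammingLoss_left {Ω : Type*} [MeasurableSpace Ω] {n : ℕ} (a : Fin n → ℝ)
    {f : Ω → Fin n → ℝ} (hf : Measurable f) : Measurable fun w => hammingLoss a (f w) := by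
  unfold hammingLoss
  fun_prop

open Classical in
theorem sum_coordinateRisk {N n : ℕ} (σ b : ℝ)
    {g : (Fin N → Sym2 (Fin n) → ℝ) → Fin n → ℝ} (hg : Measurable g)
    (hg01 : ∀ w i, g w i ∈ Set.Icc 0 1) (S : Finset (Fin n)) :
    ∑ j, coordinateRisk σ b g S j = signAverage fun ε => ∫ w,
      hammingLoss (fun j => if j ∈ S then 1 else 0) (g fun l => signedSignal b S ε + w l)
        ∂noiseLaw N n σ := by
  simp only [coordinateRisk]
  rw [← signAverage_sum]
  congr 1
  ext ε
  simp only [hammingLoss]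
  rw [integral_finsetSum]
  intro j _
  have h1 : Measurable fun w : Fin N → Sym2 (Fin n) → ℝ => g fun l => signedSignal b S ε + w l :=
    hg.comp (measurable_translate _)
  have h2 : Measurable fun w : Fin N → Sym2 (Fin n) → ℝ =>
      |(if j ∈ S then (1 : ℝ) else 0) - g (fun l => signedSignal b S ε + w l) j| := by fun_prop
  refine Integrable.of_bound (C := 1) h2.aestronglyMeasurable (ae_of_all _ fun w => ?_)
  have h := hg01 (fun l => signedSignal b S ε + w l) j
  rw [Real.norm_eq_abs, abs_abs, abs_le]
  split_ifs <;> constructor <;> linarith [h.1, h.2]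

theorem supportIndicator_signedSignal {n : ℕ} {b : ℝ} (hb : 0 < b) (S : Finset (Fin n))
    (ε : Sym2 (Fin n) → ℤˣ) [DecidablePred (· ∈ S)] :
    supportIndicator (noiseMatrix (signedSignal b S ε)) = fun j => if j ∈ S then 1 else 0 := by
  ext j
  simp only [supportIndicator, nodeSupport_signedSignal hb]

open Classical in
/-- The truncated estimator has risk at most that of `e` on supports of size at most `m`. -/
theorem ofReal_integral_truncatedEstimator_le {N n m : ℕ} {σ b : ℝ} (hb : 0 < b)
    {e : (Fin N → Fin n → Fin n → ℝ) → Fin n → ℝ} (hm : Measurable e)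
    {S : Finset (Fin n)} (hS : S.card ≤ m) (ε : Sym2 (Fin n) → ℤˣ) :
    ENNReal.ofReal (∫ w, hammingLoss (fun j => if j ∈ S then 1 else 0)
        (truncatedEstimator m e fun l => signedSignal b S ε + w l) ∂noiseLaw N n σ) ≤
      hammingRisk σ e (noiseMatrix (signedSignal b S ε)) := by
  have h0 : ∀ a c : Fin n → ℝ, 0 ≤ hammingLoss a c :=
    fun a c => Finset.sum_nonneg fun _ _ => abs_nonneg _
  have hle : ∀ w : Fin N → Sym2 (Fin n) → ℝ, hammingLoss (fun j => if j ∈ S then 1 else 0)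
      (truncatedEstimator m e fun l => signedSignal b S ε + w l) ≤
        hammingLoss (supportIndicator (noiseMatrix (signedSignal b S ε)))
          (e (observations (noiseMatrix (signedSignal b S ε)) w)) := by
    intro w
    rw [supportIndicator_signedSignal hb, observations_noiseMatrix]
    exact hammingLoss_truncatedEstimator_le hS _
  have hmeas : Measurable fun w : Fin N → Sym2 (Fin n) → ℝ =>
      hammingLoss (fun j => if j ∈ S then 1 else 0)
        (truncatedEstimator m e fun l => signedSignal b S ε + w l) :=
    measurable_hammingLoss_left _
      ((measurable_truncatedEstimator m hm).comp (measurable_translate _))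
  rw [integral_eq_lintegral_of_nonneg_ae (ae_of_all _ fun w => h0 _ _)
    hmeas.aestronglyMeasurable]
  exact ENNReal.ofReal_toReal_le.trans
    (lintegral_mono fun w => ENNReal.ofReal_le_ofReal (hle w))

/-! ### The minimax bound -/

/-- Minimax lower bound for a signal strength `b`, in terms of the second moment of the likelihood
ratio and a binomial tail. -/
theorem minimax_lower_bound_of_moment {N n m : ℕ} {σ b β p : ℝ} (hσ : 0 < σ) (hb : 0 < b)
    (hβ : β ≤ b) (hp0 : 0 < p) (hp1 : p < 1) :
    ENNReal.ofReal
      (n * (p * (1 - p * Real.exp (n * ((N * b ^ 2 / σ ^ 2) ^ 2 / 2)) / (4 * (1 - p)))) -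
        3 * ∑ S : Finset (Fin n), (if m < S.card then bernoulliWeight p S * S.card else 0)) ≤
      minimaxHammingRisk N n m σ β := by
  classical
  refine le_iInf fun e => le_iInf fun hm => le_iInf fun he => ?_
  set ρ := ⨆ B ∈ restrictedClass β n m, hammingRisk σ e B with hρ
  rcases eq_or_ne ρ ⊤ with htop | htop
  · rw [htop]; exact le_top
  refine ENNReal.ofReal_le_of_le_toReal ?_
  set g := truncatedEstimator m e
  have hgm : Measurable g := measurable_truncatedEstimator m hm
  have hg01 : ∀ w i, g w i ∈ Set.Icc (0 : ℝ) 1 := truncatedEstimator_mem_Icc m he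
  have hsmall : ∀ S : Finset (Fin n), S.card ≤ m → ∑ j, coordinateRisk σ b g S j ≤ ρ.toReal := by
    intro S hS
    rw [sum_coordinateRisk σ b hgm hg01, ← signAverage_const n ρ.toReal]
    refine signAverage_mono fun ε => ?_
    refine (ENNReal.ofReal_le_iff_le_toReal htop).1 ?_
    exact (ofReal_integral_truncatedEstimator_le hb hm hS ε).trans
      (le_iSup₂ (f := fun B (_ : B ∈ restrictedClass β n m) => hammingRisk σ e B) _
        (signedSignal_mem_restrictedClass hb hβ hS ε))
  have hlarge : ∀ S : Finset (Fin n), m < S.card →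
      ∑ j, coordinateRisk σ b g S j ≤ 3 * S.card := by
    intro S hS
    rw [sum_coordinateRisk σ b hgm hg01, ← signAverage_const n (3 * S.card : ℝ)]
    refine signAverage_mono fun ε => ?_
    refine (integral_mono_of_nonneg (ae_of_all _ fun w => Finset.sum_nonneg fun _ _ =>
      abs_nonneg _) (integrable_const (3 * S.card : ℝ)) (ae_of_all _ fun w =>
        hammingLoss_truncatedEstimator_le_of_lt he hS _)).trans ?_
    simp
  have hbayes := bayes_risk_lower_bound (b := b) hσ hp0 hp1 hgm hg01
  have hsum : ∑ S, bernoulliWeight p S * ∑ j, coordinateRisk σ b g S j ≤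
      ∑ S : Finset (Fin n), (bernoulliWeight p S * ρ.toReal +
        3 * if m < S.card then bernoulliWeight p S * S.card else 0) := by
    refine Finset.sum_le_sum fun S _ => ?_
    have hw := bernoulliWeight_nonneg hp0.le hp1.le S
    split_ifs with h
    · have h1 := mul_le_mul_of_nonneg_left (hlarge S h) hw
      have h2 := mul_nonneg hw (ENNReal.toReal_nonneg (a := ρ))
      linarith
    · have h1 := mul_le_mul_of_nonneg_left (hsmall S (not_lt.1 h)) hw
      linarith
  rw [Finset.sum_add_distrib, ← Finset.sum_mul, sum_bernoulliWeight, one_mul,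
    ← Finset.mul_sum] at hsum
  linarith

theorem theorem4p7 :
    ∃ C : ℝ, 0 < C ∧ ∃ n₀ : ℕ, ∀ n : ℕ, n₀ ≤ n →
      ∀ (N m : ℕ) (m' σ β : ℝ), 1 ≤ N → 3 * m < n → 1 ≤ m' → m' ≤ (m : ℝ) → 0 < σ →
        β < C * σ * (n : ℝ) ^ (-(1 / 4) : ℝ) * Real.log ((n : ℝ) / (3 * m')) ^ ((1 / 4) : ℝ)
            / √(N : ℝ) →
        ENNReal.ofReal
            (4 * m' * (1 / 8 - Real.exp (-(((m : ℝ) - m') ^ 2 / (2 * (m : ℝ))))))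
          ≤ minimaxHammingRisk N n m σ β := by
  refine ⟨1, one_pos, 0, fun n _ N m m' σ β hN hmn hm1 hm'm hσ hβ => ?_⟩
  have hN0 : (0 : ℝ) < N := by exact_mod_cast hN
  have hmn' : 3 * (m : ℝ) < n := by exact_mod_cast hmn
  have hm0 : 0 < m' := by linarith
  have hn0 : (0 : ℝ) < n := by linarith
  set x : ℝ := n / (3 * m') with hx
  have hx1 : 1 < x := (one_lt_div (by linarith)).2 (by linarith)
  have hlog : 0 < Real.log x := Real.log_pos hx1
  set b : ℝ := 1 * σ * (n : ℝ) ^ (-(1 / 4) : ℝ) * Real.log x ^ ((1 / 4) : ℝ) / √(N : ℝ) with hbdef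
  have hb : 0 < b := by positivity
  set p : ℝ := m' / n with hp
  have hnp : n * p = m' := mul_div_cancel₀ _ hn0.ne'
  have hp0 : 0 < p := by positivity
  have hp3 : p < 1 / 3 := (div_lt_iff₀ hn0).2 (by linarith)
  -- At the threshold value of `b`, `N`, `σ` and `n` cancel, so the second-moment bound is `√x`,
  -- which is more than enough for the bound by `x` used below.
  have hb4 : n * ((N * b ^ 2 / σ ^ 2) ^ 2 / 2) = Real.log x / 2 := by
    have h1 : ((n : ℝ) ^ (-(1 / 4) : ℝ)) ^ 4 = (n : ℝ)⁻¹ := by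
      rw [← Real.rpow_natCast, ← Real.rpow_mul hn0.le, ← Real.rpow_neg_one]
      norm_num
    have h2 : (Real.log x ^ ((1 / 4) : ℝ)) ^ 4 = Real.log x := by
      rw [← Real.rpow_natCast, ← Real.rpow_mul hlog.le]
      norm_num
    have h3 : (√(N : ℝ)) ^ 4 = (N : ℝ) ^ 2 := by
      rw [show 4 = 2 * 2 from rfl, pow_mul, Real.sq_sqrt hN0.le]
    have h4 : b ^ 4 = σ ^ 4 * (n : ℝ)⁻¹ * Real.log x / (N : ℝ) ^ 2 := by
      rw [hbdef, div_pow, mul_pow, mul_pow, h1, h2, h3, one_mul]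
    have h5 : (N * b ^ 2 / σ ^ 2) ^ 2 = N ^ 2 * b ^ 4 / σ ^ 4 := by ring
    rw [h5, h4]
    field_simp
  have hexp : Real.exp (n * ((N * b ^ 2 / σ ^ 2) ^ 2 / 2)) ≤ x := by
    rw [hb4]
    exact (Real.exp_le_exp.2 (by linarith)).trans (Real.exp_log (by linarith)).le
  have hpx : p * x = 1 / 3 := by
    rw [hp, hx]
    field_simp
  -- The numerator is at most `p x = 1/3`, while `p < 1/3` gives `4 (1 - p) > 8/3`.
  have hfrac : p * Real.exp (n * ((N * b ^ 2 / σ ^ 2) ^ 2 / 2)) / (4 * (1 - p)) ≤ 1 / 8 := by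
    rw [div_le_iff₀ (by linarith)]
    have := mul_le_mul_of_nonneg_left hexp hp0.le
    linarith
  have htail := sum_bernoulliWeight_card_gt_le_exp (n := n) (m := m) (by exact_mod_cast hn0) hm0
    hm'm (by linarith)
  refine le_trans (ENNReal.ofReal_le_ofReal ?_)
    (minimax_lower_bound_of_moment hσ hb hβ.le hp0 (by linarith))
  rw [← mul_assoc, hnp]
  have hE := mul_pos hm0 (Real.exp_pos (-(((m : ℝ) - m') ^ 2 / (2 * (m : ℝ)))))
  have h1 := mul_le_mul_of_nonneg_left hfrac hm0.le
  -- With `E` the exponential, the bound obtained is at least `m' (7/8 - 3 E)`, which dominates `m'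
  -- (1/2 - 4 E)`.
  nlinarith
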